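/- Let $X$ be a compact metric space, let $T\colon X\to X$ be a continuous map, and suppose that $(X,T)$ is uniquely ergodic, i.e. there is exactly one Borel probability measure $\mu$ on $X$ that is $T$-invariant (meaning $\mu(T^{-1}A)=\mu(A)$ for every Borel set $A\subseteq X$). For a positive integer $n$ let $\omega(n)$ denote the number of distinct primes dividing $n$. Then for every continuous function $f\colon X\to\mathbb{C}$ and every point $x\in X$, $$\lim_{N\to\infty}\frac1N\sum_{n=1}^N f\big(T^{\omega(n)}x\big)=\int_X f\,d\mu .$$ -/

import Mathlib

/-- `μ` is the unique `T`-invariant Borel probability measure on `X`: it is a `T`-invariant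
probability measure, and every `T`-invariant probability measure equals `μ`. -/
structure IsUniquelyErgodic {X : Type*} [MeasurableSpace X] (T : X → X)
    (μ : MeasureTheory.Measure X) : Prop where
  isProbabilityMeasure : MeasureTheory.IsProbabilityMeasure μ
  invariant : MeasureTheory.MeasurePreserving T μ μ
  unique : ∀ ν : MeasureTheory.Measure X, MeasureTheory.IsProbabilityMeasure ν →
    MeasureTheory.MeasurePreserving T ν ν → ν = μ

/-! The uniform measures on the points `T^[ω n] x`, `n ≤ N + 1`, live in the weakly compact space of
probability measures, so it suffices that each weak limit is `T`-invariant. This reduces to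
arithmetic: for bounded `f`, the averages of `f (ω n)` and `f (ω n + 1)` agree asymptotically.

By a weighted Turán–Kubilius inequality, the average of `f ∘ ω` at `x` is close to a weighted mean,
over a heavy set of primes `p`, of averages of `f (ω + 1)` at `x / p`
(`norm_omegaAverage_sub_sum_le`). Replacing `x / p` by `x` requires slow variation
(`eventually_norm_omegaAverage_div_sub_le`). To compare scales `x / r` and `x`, expand the first
along primes `p` and the second along partners `q` with `ρ ≤ q / p ≤ β`, using common weights `1 /
q`. The scales `x / (r p)` and `x / q` then differ by a factor at most `r / ρ`, and iterating brings
the factor down to nearly `1`, where the trivial bound applies. Chebyshev-type estimates provide the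
pairs (`exists_prime_pairs`); the prime number theorem is not needed. -/

/-! ### Pairs of primes with controlled ratio -/

/-- The primes in `(a, b]` all divide `b.choose (b - a)`, which makes them scarce when `b / a` is
close to `1`. -/
theorem card_primes_Ioc_mul_log_le_log_choose {a b : ℕ} (ha : 0 < a) (hab : a ≤ b)
    (hb : b ≤ 2 * a) :
    (((Finset.Ioc a b).filter Nat.Prime).card : ℝ) * Real.log a
      ≤ Real.log (b.choose (b - a)) := by
  have hdvd : ∏ p ∈ (Finset.Ioc a b).filter Nat.Prime, p ∣ b.choose (b - a) := by
    refine Finset.prod_primes_dvd _ (fun p hp => (Finset.mem_filter.1 hp).2.prime) ?_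
    intro p hp
    obtain ⟨hp1, hp⟩ := Finset.mem_filter.1 hp
    obtain ⟨h1, h2⟩ := Finset.mem_Ioc.1 hp1
    have h3 : p ∣ b.choose (b - a) * (b - a).factorial * (b - (b - a)).factorial := by
      rw [Nat.choose_mul_factorial_mul_factorial (Nat.sub_le _ _)]
      exact (hp.dvd_factorial).2 h2
    rcases hp.dvd_mul.1 h3 with h | h
    · rcases hp.dvd_mul.1 h with h | h
      · exact h
      · have := hp.dvd_factorial.1 h
        omega
    · have := hp.dvd_factorial.1 h
      omega
  have hpos : 0 < b.choose (b - a) := Nat.choose_pos (Nat.sub_le _ _)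
  have hle : a ^ ((Finset.Ioc a b).filter Nat.Prime).card ≤ b.choose (b - a) := by
    refine le_trans ?_ (Nat.le_of_dvd hpos hdvd)
    refine Finset.pow_card_le_prod _ _ _ fun p hp => ?_
    exact (Finset.mem_Ioc.1 (Finset.mem_filter.1 hp).1).1.le
  rw [← Real.log_pow]
  refine Real.log_le_log (by positivity) ?_
  exact_mod_cast hle

/-- A single term of the expansion of `(1 + x) ^ n` is at most the whole; take logarithms. The free
`x` balances the two resulting terms. -/
theorem log_choose_le (n k : ℕ) (hk : k ≤ n) {x : ℝ} (hx : 0 < x) :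
    Real.log (n.choose k) ≤ n * x + k / x := by
  have h1 : (n.choose k : ℝ) * x ^ k ≤ (1 + x) ^ n := by
    rw [add_comm, add_pow]
    have := Finset.single_le_sum (f := fun m => x ^ m * 1 ^ (n - m) * (n.choose m : ℝ))
      (fun i _ => by positivity) (Finset.mem_range.2 (Nat.lt_succ_of_le hk))
    simpa [mul_comm] using this
  have hc : (0 : ℝ) < n.choose k := by exact_mod_cast Nat.choose_pos hk
  have h2 := Real.log_le_log (by positivity) h1
  rw [Real.log_mul hc.ne' (by positivity), Real.log_pow, Real.log_pow] at h2
  have h3 : Real.log (1 + x) ≤ x := by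
    have := Real.log_le_sub_one_of_pos (show 0 < 1 + x by positivity)
    linarith
  have h4 : -Real.log x ≤ 1 / x := by
    have := Real.log_le_sub_one_of_pos (show 0 < x⁻¹ by positivity)
    rw [Real.log_inv] at this
    rw [one_div]; linarith
  have h5 := mul_le_mul_of_nonneg_left h3 (Nat.cast_nonneg (α := ℝ) n)
  have h6 := mul_le_mul_of_nonneg_left h4 (Nat.cast_nonneg (α := ℝ) k)
  have h7 : (k : ℝ) / x = k * (1 / x) := by ring
  rw [h7]
  linarith

theorem exists_card_primes_Ioc_mul_log_le {τ : ℝ} (hτ : 0 < τ) :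
    ∃ ρ : ℝ, 1 < ρ ∧ ∀ a b : ℕ, 0 < a → a ≤ b → (b : ℝ) ≤ ρ * a →
      (((Finset.Ioc a b).filter Nat.Prime).card : ℝ) * Real.log a ≤ τ * b := by
  -- The `1` ensures `b ≤ 2 * a`; the `τ ^ 2 / 4` makes both terms of `log_choose_le` at `x = τ / 2`
  -- at most `τ / 2 * b`.
  refine ⟨1 + min 1 (τ ^ 2 / 4), by have : 0 < min 1 (τ ^ 2 / 4) := by positivity
                                    linarith, fun a b ha hab hb => ?_⟩
  have ha' : (0 : ℝ) < a := by exact_mod_cast ha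
  have hab' : (a : ℝ) ≤ b := by exact_mod_cast hab
  have h2 : b ≤ 2 * a := by
    have : (b : ℝ) ≤ 2 * a := by nlinarith [min_le_left 1 (τ ^ 2 / 4)]
    exact_mod_cast this
  refine (card_primes_Ioc_mul_log_le_log_choose ha hab h2).trans ?_
  refine (log_choose_le b (b - a) (Nat.sub_le _ _) (half_pos hτ)).trans ?_
  rw [Nat.cast_sub hab]
  have h3 : ((b : ℝ) - a) ≤ τ ^ 2 / 4 * b := by
    have h4 := min_le_right 1 (τ ^ 2 / 4)
    have h5 := mul_le_mul_of_nonneg_right h4 ha'.le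
    have h6 : τ ^ 2 / 4 * a ≤ τ ^ 2 / 4 * b := by gcongr
    linarith
  have h7 : ((b : ℝ) - a) / (τ / 2) ≤ τ / 2 * b := by
    rw [div_le_iff₀ (by positivity)]
    linarith
  linarith

/-- The sum telescopes to the last `m` terms minus the first `m`. -/
theorem sum_shift_sub_le {v : ℕ → ℝ} {r m : ℕ} {c d : ℝ}
    (hc : ∀ i < r + m, c ≤ v i) (hd : ∀ i < r + m, v i ≤ d) :
    ∑ i ∈ Finset.range r, (v (i + m) - v i) ≤ m * (d - c) := by
  have h1 : ∑ i ∈ Finset.range (m + r), v i = ∑ i ∈ Finset.range (r + m), v i := by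
    rw [add_comm]
  rw [Finset.sum_range_add, Finset.sum_range_add] at h1
  have h2 : ∑ i ∈ Finset.range m, (v (r + i) - v i) ≤ ∑ _i ∈ Finset.range m, (d - c) := by
    refine Finset.sum_le_sum fun i hi => ?_
    have := Finset.mem_range.1 hi
    exact sub_le_sub (hd _ (by omega)) (hc _ (by omega))
  simp only [Finset.sum_sub_distrib, Finset.sum_const, Finset.card_range, nsmul_eq_mul] at h2
  rw [Finset.sum_sub_distrib]
  simp only [add_comm _ m]
  linarith

/-- In a long increasing sequence confined to `(N, 4 * N]`, most terms are close to the one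
`m` places further on. -/
theorem card_close_shift_ge {u : ℕ → ℕ} {N r m : ℕ} (hN : 0 < N) {β : ℝ} (hβ : 1 < β)
    (hmono : StrictMono u) (hlo : ∀ i < r + m, N < u i) (hhi : ∀ i < r + m, u i ≤ 4 * N) :
    (r : ℝ) - m * (Real.log 4 / Real.log β) ≤
      (((Finset.range r).filter fun i => (u (i + m) : ℝ) ≤ β * u i).card : ℝ) := by
  have hβ' : 0 < Real.log β := Real.log_pos hβ
  have hN' : (0 : ℝ) < N := by exact_mod_cast hN
  have h1 := sum_shift_sub_le (v := fun i => Real.log (u i)) (r := r) (m := m)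
    (c := Real.log N) (d := Real.log (4 * N))
    (fun i hi => Real.log_le_log hN' (by exact_mod_cast (hlo i hi).le))
    (fun i hi => Real.log_le_log (by exact_mod_cast (hN.trans (hlo i hi)))
      (by exact_mod_cast hhi i hi))
  rw [Real.log_mul (by norm_num) hN'.ne', add_sub_cancel_right] at h1
  -- Markov's inequality: each bad index contributes at least `log β` to a sum of nonnegative terms
  -- bounded by `m * log 4`.
  have h2 : (((Finset.range r).filter fun i => ¬ (u (i + m) : ℝ) ≤ β * u i).card : ℝ)
      * Real.log β ≤ m * Real.log 4 := by
    refine le_trans ?_ h1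
    rw [← nsmul_eq_mul, ← Finset.sum_const]
    refine le_trans (Finset.sum_le_sum (g := fun i => Real.log (u (i + m)) - Real.log (u i)) ?_)
      (Finset.sum_le_sum_of_subset_of_nonneg (Finset.filter_subset _ _) ?_)
    · intro i hi
      obtain ⟨hi1, hi⟩ := Finset.mem_filter.1 hi
      have hi1 := Finset.mem_range.1 hi1
      have hu : (0 : ℝ) < u i := by exact_mod_cast hN.trans (hlo i (by omega))
      have := Real.log_le_log (by positivity) (not_le.1 hi).le
      rw [Real.log_mul (by positivity) hu.ne'] at this
      linarith
    · intro i hi _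
      have hi1 := Finset.mem_range.1 hi
      rw [sub_nonneg]
      refine Real.log_le_log (by exact_mod_cast hN.trans (hlo i (by omega))) ?_
      exact_mod_cast hmono.monotone (Nat.le_add_right i m)
  have h3 : (((Finset.range r).filter fun i => (u (i + m) : ℝ) ≤ β * u i).card : ℝ)
      + (((Finset.range r).filter fun i => ¬ (u (i + m) : ℝ) ≤ β * u i).card : ℝ) = r := by
    have := Finset.card_filter_add_card_filter_not (s := Finset.range r)
      (fun i => (u (i + m) : ℝ) ≤ β * u i)
    rw [Finset.card_range] at this
    exact_mod_cast this
  have h4 : (((Finset.range r).filter fun i => ¬ (u (i + m) : ℝ) ≤ β * u i).card : ℝ)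
      ≤ m * (Real.log 4 / Real.log β) := by
    rw [← mul_div_assoc, le_div_iff₀ hβ']
    exact h2
  linarith

/-- Chebyshev's lower bound for the primes in `(N, 4 * N]`. -/
theorem eventually_card_primes_Ioc_ge :
    ∀ᶠ N : ℕ in Filter.atTop,
      (N : ℝ) / (2 * Real.log N) ≤ (((Finset.Ioc N (4 * N)).filter Nat.Prime).card : ℝ) := by
  have hlim2 : Filter.Tendsto (fun x : ℝ => Real.log x / Real.sqrt x) Filter.atTop (nhds 0) := by
    have := (isLittleO_log_rpow_atTop (show (0 : ℝ) < 1 / 2 by norm_num)).tendsto_div_nhds_zero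
    simpa [Real.sqrt_eq_rpow] using this
  have hc : Filter.Tendsto (fun N : ℕ => ((4 * N : ℕ) : ℝ)) Filter.atTop Filter.atTop := by
    refine tendsto_natCast_atTop_atTop.comp ?_
    exact Filter.tendsto_id.const_mul_atTop' (by norm_num)
  have e1 := (hlim2.comp hc).eventually (gt_mem_nhds (show (0 : ℝ) < 1 / 100 by norm_num))
  filter_upwards [e1, Filter.eventually_ge_atTop 100] with N h1 hN
  have hN' : (100 : ℝ) ≤ N := by exact_mod_cast hN
  set M : ℝ := ((4 * N : ℕ) : ℝ) with hM
  have hM4 : M = 4 * N := by rw [hM]; push_cast; ring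
  have hM0 : 0 < M := by rw [hM4]; positivity
  have hs : 0 < Real.sqrt M := Real.sqrt_pos.2 hM0
  have hss : Real.sqrt M * Real.sqrt M = M := Real.mul_self_sqrt hM0.le
  have hlogM : Real.log M ≤ 1 / 100 * Real.sqrt M := by
    have : Real.log M / Real.sqrt M < 1 / 100 := h1
    rw [div_lt_iff₀ hs] at this
    exact this.le
  have hlog1 : Real.log (M + 1) ≤ Real.log M + 1 := by
    have : Real.log (M + 1) ≤ Real.log (M * Real.exp 1) := by
      refine Real.log_le_log (by positivity) ?_
      nlinarith [Real.add_one_le_exp 1]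
    rwa [Real.log_mul hM0.ne' (by positivity), Real.log_exp] at this
  have hge := Chebyshev.theta_ge (4 * N)
  have hle := Chebyshev.theta_le_log4_mul_x (Nat.cast_nonneg (α := ℝ) N)
  have hlog4 : Real.log 4 = 2 * Real.log 2 := by
    rw [show (4 : ℝ) = 2 ^ 2 by norm_num, Real.log_pow]; norm_num
  have hl2 := Real.log_two_gt_d9
  -- The endpoint `4 * N` leaves a main term `(4 log 2 - 2 log 2) N > N`; with `2 * N` the two main
  -- terms would cancel.
  have hdiff : (N : ℝ) ≤ Chebyshev.theta M - Chebyshev.theta N := by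
    have h2 : 2 * Real.sqrt M * Real.log M ≤ M / 50 := by nlinarith
    have h3 : Real.sqrt M ≤ M := by nlinarith [Real.one_le_sqrt.2 (show 1 ≤ M by linarith)]
    rw [← hM] at hge
    rw [hlog4] at hle
    nlinarith
  have hlogN : Real.log M ≤ 2 * Real.log N := by
    have : Real.log M ≤ Real.log ((N : ℝ) ^ 2) :=
      Real.log_le_log hM0 (by rw [hM4]; nlinarith)
    simpa using this
  have hsum : Chebyshev.theta M - Chebyshev.theta N =
      ∑ p ∈ (Finset.Ioc N (4 * N)).filter Nat.Prime, Real.log p := by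
    rw [hM, Chebyshev.theta, Chebyshev.theta, Nat.floor_natCast, Nat.floor_natCast, sub_eq_iff_eq_add,
      ← Finset.sum_union]
    · congr 1
      ext p
      simp only [Finset.mem_union, Finset.mem_filter, Finset.mem_Ioc]
      have : N ≤ 4 * N := by omega
      constructor
      · rintro ⟨⟨h1, h2⟩, h3⟩
        by_cases h : p ≤ N
        · exact Or.inr ⟨⟨h1, h⟩, h3⟩
        · exact Or.inl ⟨⟨by omega, h2⟩, h3⟩
      · rintro (⟨⟨h1, h2⟩, h3⟩ | ⟨⟨h1, h2⟩, h3⟩)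
        · exact ⟨⟨by omega, h2⟩, h3⟩
        · exact ⟨⟨h1, by omega⟩, h3⟩
    · rw [Finset.disjoint_left]
      intro p hp hp'
      simp only [Finset.mem_filter, Finset.mem_Ioc] at hp hp'
      omega
  have hcard : ∑ p ∈ (Finset.Ioc N (4 * N)).filter Nat.Prime, Real.log p
      ≤ (((Finset.Ioc N (4 * N)).filter Nat.Prime).card : ℝ) * (2 * Real.log N) := by
    rw [← nsmul_eq_mul]
    refine Finset.sum_le_card_nsmul _ _ _ fun p hp => ?_
    simp only [Finset.mem_filter, Finset.mem_Ioc] at hp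
    refine le_trans (Real.log_le_log (by exact_mod_cast hp.2.pos) ?_) hlogN
    rw [hM]
    exact_mod_cast hp.1.2
  have hlogpos : 0 < Real.log N := Real.log_pos (by linarith)
  rw [div_le_iff₀ (by positivity)]
  linarith

theorem card_primes_Ioc_eq_count_sub (a b : ℕ) (hab : a ≤ b) :
    Nat.count Nat.Prime (a + 1) + ((Finset.Ioc a b).filter Nat.Prime).card
      = Nat.count Nat.Prime (b + 1) := by
  rw [Nat.count_eq_card_filter_range, Nat.count_eq_card_filter_range, ← Finset.card_union_of_disjoint]
  · congr 1
    ext p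
    simp only [Finset.mem_union, Finset.mem_filter, Finset.mem_Ioc, Finset.mem_range]
    by_cases hp : p.Prime
    · simp only [hp, and_true]; omega
    · simp [hp]
  · rw [Finset.disjoint_left]
    intro p hp hp'
    simp only [Finset.mem_filter, Finset.mem_Ioc, Finset.mem_range] at hp hp'
    omega

/-- Each prime is paired with the one `m` places later, `m` being a small multiple of `N / log N`.
Telescoping logarithms keeps most ratios below `β`; scarcity of primes in short intervals forces
them above `ρ`. -/
theorem exists_prime_pairs_Ioc {β : ℝ} (hβ : 1 < β) :
    ∃ ρ : ℝ, 1 < ρ ∧ ∀ᶠ N : ℕ in Filter.atTop, ∃ R : Finset (ℕ × ℕ),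
      (∀ q ∈ R, q.1.Prime ∧ q.2.Prime ∧ q.1 ∈ Set.Ioc N (4 * N) ∧ q.2 ∈ Set.Ioc N (4 * N) ∧
        ρ * q.1 ≤ q.2 ∧ (q.2 : ℝ) ≤ β * q.1) ∧
      Set.InjOn Prod.fst (R : Set (ℕ × ℕ)) ∧ Set.InjOn Prod.snd (R : Set (ℕ × ℕ)) ∧
      1 / (16 * Real.log N) ≤ ∑ q ∈ R, 1 / (q.2 : ℝ) := by
  have hlβ := Real.log_pos hβ
  have hl4 : 0 < Real.log 4 := Real.log_pos (by norm_num)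
  set K : ℝ := 1 + Real.log 4 / Real.log β with hK
  have hK1 : 1 < K := by
    have : 0 < Real.log 4 / Real.log β := by positivity
    linarith
  -- Then `m * K` is at most half of the Chebyshev count `N / (2 log N)`, even after rounding `m`
  -- up.
  set h : ℝ := 1 / (8 * K) with hh
  have hh0 : 0 < h := by positivity
  obtain ⟨ρ, hρ, hwin⟩ := exists_card_primes_Ioc_mul_log_le (show 0 < h / 8 by positivity)
  refine ⟨ρ, hρ, ?_⟩
  have e1 : ∀ᶠ N : ℕ in Filter.atTop, Real.log N ≤ h * N := by
    have := (Real.isLittleO_log_id_atTop.bound hh0)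
    filter_upwards [tendsto_natCast_atTop_atTop.eventually this] with N hN
    simp only [id, Real.norm_eq_abs, Nat.abs_cast] at hN
    exact (le_abs_self _).trans hN
  filter_upwards [e1, eventually_card_primes_Ioc_ge, Filter.eventually_ge_atTop 2]
    with N h1 h2 hN
  have hN' : (2 : ℝ) ≤ N := by exact_mod_cast hN
  have hlog : 0 < Real.log N := Real.log_pos (by linarith)
  set n := ((Finset.Ioc N (4 * N)).filter Nat.Prime).card with hn
  set m := ⌈h * N / Real.log N⌉₊ with hm
  have hm1 : h * N / Real.log N ≤ m := Nat.le_ceil _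
  have hm2 : (m : ℝ) ≤ 2 * (h * N / Real.log N) := by
    have h3 : (m : ℝ) < h * N / Real.log N + 1 := Nat.ceil_lt_add_one (by positivity)
    have h4 : 1 ≤ h * N / Real.log N := by rwa [le_div_iff₀ hlog, one_mul]
    linarith
  have hmK : (m : ℝ) * K ≤ N / (4 * Real.log N) := by
    calc (m : ℝ) * K ≤ 2 * (h * N / Real.log N) * K := by gcongr
      _ = N / (4 * Real.log N) := by rw [hh]; field_simp; norm_num
  have hnm : (N : ℝ) / (4 * Real.log N) ≤ n - m * K := by
    have : (N : ℝ) / (2 * Real.log N) = 2 * (N / (4 * Real.log N)) := by field_simp; norm_num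
    linarith
  have hm0 : (0 : ℝ) ≤ m := Nat.cast_nonneg _
  have hmn : m ≤ n := by
    have : (m : ℝ) ≤ n := by
      have : (0 : ℝ) ≤ N / (4 * Real.log N) := by positivity
      nlinarith
    exact_mod_cast this
  have hcount := card_primes_Ioc_eq_count_sub N (4 * N) (by omega)
  set k := Nat.count Nat.Prime (N + 1) with hk
  rw [← hn] at hcount
  have hinf := Nat.infinite_setOfPred_prime
  let u : ℕ → ℕ := fun i => Nat.nth Nat.Prime (k + i)
  have humono : StrictMono u := fun i j hij => Nat.nth_strictMono hinf (by omega)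
  have huprime : ∀ i, (u i).Prime := fun i => Nat.prime_nth_prime _
  have hr : n - m + m = n := Nat.sub_add_cancel hmn
  have hlo : ∀ i, N < u i := fun i =>
    lt_of_lt_of_le (Nat.lt_succ_self N)
      ((Nat.le_nth_count hinf (N + 1)).trans (Nat.nth_monotone hinf (Nat.le_add_right k i)))
  have hhi : ∀ i < n - m + m, u i ≤ 4 * N := fun i hi =>
    Nat.lt_add_one_iff.1 (Nat.nth_lt_of_lt_count (by omega))
  have hclose := card_close_shift_ge (by omega) hβ humono (fun i _ => hlo i) hhi
  set F := (Finset.range (n - m)).filter fun i => (u (i + m) : ℝ) ≤ β * u i with hF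
  refine ⟨F.image fun i => (u i, u (i + m)), ?_, ?_, ?_, ?_⟩
  · intro q hq
    obtain ⟨i, hi, rfl⟩ := Finset.mem_image.1 hq
    obtain ⟨hi1, hi2⟩ := Finset.mem_filter.1 hi
    have hi1 := Finset.mem_range.1 hi1
    refine ⟨huprime _, huprime _, ⟨hlo _, hhi _ (by omega)⟩, ⟨hlo _, hhi _ (by omega)⟩, ?_, hi2⟩
    -- A ratio below `ρ` would put `m` primes in a short interval, giving `h * N ≤ m * log N ≤ (h /
    -- 8) * (4 * N)`.
    by_contra! hlt
    have hle : u i ≤ u (i + m) := humono.monotone (Nat.le_add_right _ _)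
    have hw := hwin (u i) (u (i + m)) (huprime i).pos hle hlt.le
    have hc := card_primes_Ioc_eq_count_sub (u i) (u (i + m)) hle
    simp only [u, Nat.count_nth_succ_of_infinite hinf] at hc
    have hc' : ((Finset.Ioc (u i) (u (i + m))).filter Nat.Prime).card = m := by
      simp only [u]; omega
    rw [hc'] at hw
    have h5 : Real.log N ≤ Real.log (u i) :=
      Real.log_le_log (by linarith) (by exact_mod_cast (hlo i).le)
    have h6 : (u (i + m) : ℝ) ≤ 4 * N := by exact_mod_cast hhi (i + m) (by omega)
    rw [div_le_iff₀ hlog] at hm1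
    have h7 : (m : ℝ) * Real.log N ≤ m * Real.log (u i) := by gcongr
    have h8 : h / 8 * (u (i + m) : ℝ) ≤ h / 8 * (4 * N) := by gcongr
    have h9 : 0 < h * N := by positivity
    linarith
  · rw [Finset.coe_image]
    rintro _ ⟨i, _, rfl⟩ _ ⟨j, _, rfl⟩ hij
    have := humono.injective hij
    rw [this]
  · rw [Finset.coe_image]
    rintro _ ⟨i, _, rfl⟩ _ ⟨j, _, rfl⟩ hij
    have := humono.injective hij
    rw [Nat.add_right_cancel this]
  · rw [Finset.sum_image (by
      intro i _ j _ hij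
      exact humono.injective (Prod.ext_iff.1 hij).1)]
    have h5 : (F.card : ℝ) * (1 / (4 * N)) ≤ ∑ i ∈ F, 1 / ((u (i + m) : ℕ) : ℝ) := by
      rw [← nsmul_eq_mul]
      refine Finset.card_nsmul_le_sum _ _ _ fun i hi => ?_
      have hi1 := Finset.mem_range.1 (Finset.mem_filter.1 hi).1
      refine one_div_le_one_div_of_le (by exact_mod_cast (huprime _).pos) ?_
      exact_mod_cast hhi (i + m) (by omega)
    refine le_trans ?_ h5
    have h6 : (N : ℝ) / (4 * Real.log N) ≤ F.card := by
      refine hnm.trans (le_trans (le_of_eq ?_) hclose)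
      rw [Nat.cast_sub hmn, hK]; ring
    calc 1 / (16 * Real.log N) = N / (4 * Real.log N) * (1 / (4 * N)) := by field_simp; norm_num
      _ ≤ _ := by gcongr

/-- There are arbitrarily heavy finite families of pairs of distinct primes whose ratios are
bounded away from `1` and close to `1`. -/
theorem exists_prime_pairs {β : ℝ} (hβ : 1 < β) :
    ∃ ρ : ℝ, 1 < ρ ∧ ∀ L : ℝ, ∃ R : Finset (ℕ × ℕ),
      (∀ q ∈ R, q.1.Prime ∧ q.2.Prime ∧ ρ * q.1 ≤ q.2 ∧ (q.2 : ℝ) ≤ β * q.1) ∧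
      Set.InjOn Prod.fst (R : Set (ℕ × ℕ)) ∧ Set.InjOn Prod.snd (R : Set (ℕ × ℕ)) ∧
      L ≤ ∑ q ∈ R, 1 / (q.2 : ℝ) := by
  obtain ⟨ρ, hρ, hev⟩ := exists_prime_pairs_Ioc hβ
  refine ⟨ρ, hρ, fun L => ?_⟩
  obtain ⟨N₀, hN₀⟩ := Filter.eventually_atTop.1 hev
  have hN (j : ℕ) : N₀ ≤ 4 ^ (N₀ + j + 1) :=
    (Nat.lt_pow_self (by norm_num : 1 < 4)).le.trans
      (Nat.pow_le_pow_right (by norm_num) (by omega))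
  choose R hR hinj1 hinj2 hsum using fun j : ℕ => hN₀ _ (hN j)
  have hidx : ∀ {j k a : ℕ}, a ∈ Set.Ioc (4 ^ (N₀ + j + 1)) (4 * 4 ^ (N₀ + j + 1)) →
      a ∈ Set.Ioc (4 ^ (N₀ + k + 1)) (4 * 4 ^ (N₀ + k + 1)) → j = k := by
    have key : ∀ {j k a : ℕ}, a ∈ Set.Ioc (4 ^ (N₀ + j + 1)) (4 * 4 ^ (N₀ + j + 1)) →
      a ∈ Set.Ioc (4 ^ (N₀ + k + 1)) (4 * 4 ^ (N₀ + k + 1)) → ¬ j < k := by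
      rintro j k a ⟨_, h2⟩ ⟨h3, _⟩ hjk
      have : 4 * 4 ^ (N₀ + j + 1) ≤ 4 ^ (N₀ + k + 1) := by
        rw [← pow_succ']
        exact Nat.pow_le_pow_right (by norm_num) (by omega)
      omega
    intro j k a h1 h2
    exact le_antisymm (not_lt.1 (key h2 h1)) (not_lt.1 (key h1 h2))
  have hl4 : 0 < Real.log 4 := Real.log_pos (by norm_num)
  -- Block `j` has `log N = (N₀ + j + 1) log 4 ≤ (N₀ + 1) (j + 1) log 4`, so its mass is at least `c
  -- / (j + 1)` and the harmonic series diverges.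
  set c : ℝ := 1 / (16 * ((N₀ + 1) * Real.log 4)) with hc
  have hc0 : 0 < c := by positivity
  obtain ⟨J, hJ⟩ := ((Real.tendsto_sum_range_one_div_nat_succ_atTop.const_mul_atTop
    hc0).eventually_ge_atTop L).exists
  refine ⟨(Finset.range J).biUnion R, ?_, ?_, ?_, ?_⟩
  · intro q hq
    obtain ⟨j, _, hq⟩ := Finset.mem_biUnion.1 hq
    obtain ⟨h1, h2, _, _, h3, h4⟩ := hR j q hq
    exact ⟨h1, h2, h3, h4⟩
  · intro p hp q hq hpq
    obtain ⟨j, _, hp⟩ := Finset.mem_biUnion.1 (Finset.mem_coe.1 hp)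
    obtain ⟨k, _, hq⟩ := Finset.mem_biUnion.1 (Finset.mem_coe.1 hq)
    have h1 := (hR j p hp).2.2.1
    rw [hpq] at h1
    obtain rfl := hidx h1 (hR k q hq).2.2.1
    exact hinj1 j hp hq hpq
  · intro p hp q hq hpq
    obtain ⟨j, _, hp⟩ := Finset.mem_biUnion.1 (Finset.mem_coe.1 hp)
    obtain ⟨k, _, hq⟩ := Finset.mem_biUnion.1 (Finset.mem_coe.1 hq)
    have h1 := (hR j p hp).2.2.2.1
    rw [hpq] at h1
    obtain rfl := hidx h1 (hR k q hq).2.2.2.1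
    exact hinj2 j hp hq hpq
  · rw [Finset.sum_biUnion]
    · refine hJ.trans ?_
      rw [Finset.mul_sum]
      refine Finset.sum_le_sum fun j _ => le_trans ?_ (hsum j)
      push_cast
      rw [Real.log_pow, hc, ← one_div_mul_one_div_rev, ← one_div_mul_one_div_rev,
        ← one_div_mul_one_div_rev, ← one_div_mul_one_div_rev]
      have h5 : ((N₀ + j + 1 : ℕ) : ℝ) ≤ (N₀ + 1) * (j + 1) := by
        push_cast
        nlinarith [mul_nonneg (Nat.cast_nonneg (α := ℝ) N₀) (Nat.cast_nonneg (α := ℝ) j)]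
      have h6 := one_div_le_one_div_of_le (by positivity) h5
      rw [← one_div_mul_one_div_rev] at h6
      calc _ = 1 / Real.log 4 * (1 / 16) * (1 / ((j : ℝ) + 1) * (1 / ((N₀ : ℝ) + 1))) := by ring
        _ ≤ 1 / Real.log 4 * (1 / 16) * (1 / ((N₀ + j + 1 : ℕ) : ℝ)) := by gcongr
        _ = _ := by ring
    · intro j _ k _ hjk
      simp only [Function.onFun]
      rw [Finset.disjoint_left]
      intro q hq hq'
      exact hjk (hidx (hR j q hq).2.2.1 (hR k q hq').2.2.1)

/-! ### Averages along `ω` and the Turán–Kubilius inequality -/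

/-- The average of `f (ω n)` over the positive integers `n ≤ x`. -/
noncomputable def omegaAverage (f : ℕ → ℂ) (x : ℝ) : ℂ :=
  (x : ℂ)⁻¹ * ∑ n ∈ Finset.Ioc 0 ⌊x⌋₊, f (ArithmeticFunction.cardDistinctFactors n)

theorem sum_Ioc_ite_dvd_eq {E : Type*} [AddCommMonoid E] (g : ℕ → E) {p : ℕ} (hp : 0 < p)
    (M : ℕ) :
    ∑ n ∈ Finset.Ioc 0 M, (if p ∣ n then g n else 0) = ∑ m ∈ Finset.Ioc 0 (M / p), g (p * m) := by
  rw [← Finset.sum_filter]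
  symm
  refine Finset.sum_nbij' (fun m => p * m) (fun n => n / p) ?_ ?_ ?_ ?_ ?_
  · intro m hm
    obtain ⟨h1, h2⟩ := Finset.mem_Ioc.1 hm
    refine Finset.mem_filter.2 ⟨Finset.mem_Ioc.2 ⟨Nat.mul_pos hp h1, ?_⟩, dvd_mul_right _ _⟩
    rw [mul_comm]
    exact (Nat.le_div_iff_mul_le hp).1 h2
  · intro n hn
    obtain ⟨h1, h2⟩ := Finset.mem_filter.1 hn
    obtain ⟨h3, h4⟩ := Finset.mem_Ioc.1 h1
    exact Finset.mem_Ioc.2 ⟨Nat.div_pos (Nat.le_of_dvd h3 h2) hp, Nat.div_le_div_right h4⟩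
  · intro m _
    exact Nat.mul_div_cancel_left m hp
  · intro n hn
    exact Nat.mul_div_cancel' (Finset.mem_filter.1 hn).2
  · intro m _
    rfl

/-- On the multiples `p * m` of a prime, `ω` is `ω m + 1` except when `p ∣ m`. -/
theorem norm_sum_multiples_sub_le {f : ℕ → ℂ} (hf : ∀ n, ‖f n‖ ≤ 1) {p : ℕ} (hp : p.Prime)
    (M : ℕ) :
    ‖∑ n ∈ Finset.Ioc 0 M, (if p ∣ n then f (ArithmeticFunction.cardDistinctFactors n) else 0)
      - ∑ m ∈ Finset.Ioc 0 (M / p), f (ArithmeticFunction.cardDistinctFactors m + 1)‖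
      ≤ 2 * (M / (p : ℝ) ^ 2) := by
  rw [sum_Ioc_ite_dvd_eq (fun n => f (ArithmeticFunction.cardDistinctFactors n)) hp.pos,
    ← Finset.sum_sub_distrib]
  refine (norm_sum_le _ _).trans ?_
  refine (Finset.sum_le_sum (g := fun m => if p ∣ m then (2 : ℝ) else 0) ?_).trans ?_
  · intro m _
    split_ifs with h
    · refine (norm_sub_le _ _).trans ?_
      linarith [hf (ArithmeticFunction.cardDistinctFactors (p * m)),
        hf (ArithmeticFunction.cardDistinctFactors m + 1)]
    · rw [ArithmeticFunction.cardDistinctFactors_mul ((Nat.Prime.coprime_iff_not_dvd hp).2 h),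
        ArithmeticFunction.cardDistinctFactors_apply_prime hp, add_comm 1, sub_self, norm_zero]
  · rw [← Finset.sum_filter, Finset.sum_const, Nat.Ioc_filter_dvd_card_eq_div, nsmul_eq_mul,
      mul_comm, Nat.div_div_eq_div_mul]
    have := Nat.cast_div_le (α := ℝ) (m := M) (n := p * p)
    rw [Nat.cast_mul, ← pow_two (p : ℝ)] at this
    linarith

section TuranKubilius

variable {ι : Type*} {s : Finset ι} {a : ι → ℕ} {w : ι → ℝ}

/-- Off the diagonal, distinct primes divide `n` jointly only if their product does. On it, `w i * a
i ≤ 1` bounds the square by its base, giving the term linear in the weights. -/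
theorem sum_sq_weighted_divisors_le [DecidableEq ι] (ha : ∀ i ∈ s, (a i).Prime)
    (hinj : Set.InjOn a s) (hw0 : ∀ i ∈ s, 0 ≤ w i) (hw1 : ∀ i ∈ s, w i * a i ≤ 1)
    {x : ℝ} (hx : 0 ≤ x) :
    ∑ n ∈ Finset.Ioc 0 ⌊x⌋₊, (∑ i ∈ s, if a i ∣ n then w i * a i else 0) ^ 2
      ≤ x * (∑ i ∈ s, w i) ^ 2 + x * ∑ i ∈ s, w i := by
  have hM : (⌊x⌋₊ : ℝ) ≤ x := Nat.floor_le hx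
  have hcount : ∀ d : ℕ, (((Finset.Ioc 0 ⌊x⌋₊).filter fun n => d ∣ n).card : ℝ) ≤ x / d := by
    intro d
    rw [Nat.Ioc_filter_dvd_card_eq_div]
    exact Nat.cast_div_le.trans (by gcongr)
  have hterm : ∀ i ∈ s, ∀ j ∈ s,
      ∑ n ∈ Finset.Ioc 0 ⌊x⌋₊,
        (if a i ∣ n then w i * a i else 0) * (if a j ∣ n then w j * a j else 0)
      ≤ x * (w i * w j) + if i = j then x * w i else 0 := by
    intro i hi j hj
    have hai : (0 : ℝ) < a i := by exact_mod_cast (ha i hi).pos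
    have haj : (0 : ℝ) < a j := by exact_mod_cast (ha j hj).pos
    have hci : 0 ≤ w i * a i := mul_nonneg (hw0 i hi) hai.le
    have hcj : 0 ≤ w j * a j := mul_nonneg (hw0 j hj) haj.le
    have hwij : 0 ≤ x * (w i * w j) := mul_nonneg hx (mul_nonneg (hw0 i hi) (hw0 j hj))
    by_cases hij : i = j
    · subst hij
      have h1 : ∀ n ∈ Finset.Ioc 0 ⌊x⌋₊,
          (if a i ∣ n then w i * a i else 0) * (if a i ∣ n then w i * a i else 0)
          ≤ if a i ∣ n then w i * a i else 0 := by
        intro n _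
        split_ifs
        · exact mul_le_of_le_one_left hci (hw1 i hi)
        · simp
      refine (Finset.sum_le_sum h1).trans ?_
      rw [← Finset.sum_filter, Finset.sum_const, nsmul_eq_mul, if_pos rfl]
      have h2 := mul_le_mul_of_nonneg_right (hcount (a i)) hci
      have h3 : x / a i * (w i * a i) = x * w i := by field_simp
      linarith
    · have h1 : ∀ n ∈ Finset.Ioc 0 ⌊x⌋₊,
          (if a i ∣ n then w i * a i else 0) * (if a j ∣ n then w j * a j else 0)
          ≤ if a i * a j ∣ n then w i * a i * (w j * a j) else 0 := by
        intro n _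
        by_cases h : a i ∣ n ∧ a j ∣ n
        · have hco : (a i).Coprime (a j) :=
            (Nat.coprime_primes (ha i hi) (ha j hj)).2 fun h => hij (hinj hi hj h)
          rw [if_pos h.1, if_pos h.2, if_pos (hco.mul_dvd_of_dvd_of_dvd h.1 h.2)]
        · have h0 : (if a i ∣ n then w i * a i else 0) * (if a j ∣ n then w j * a j else 0) = 0 := by
            rcases not_and_or.1 h with h | h <;> simp [h]
          rw [h0]
          split_ifs
          · positivity
          · rfl
      refine (Finset.sum_le_sum h1).trans ?_
      rw [← Finset.sum_filter, Finset.sum_const, nsmul_eq_mul, if_neg hij, add_zero]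
      have h2 := mul_le_mul_of_nonneg_right (hcount (a i * a j)) (mul_nonneg hci hcj)
      refine h2.trans (le_of_eq ?_)
      push_cast
      field_simp
  have hexp : ∑ n ∈ Finset.Ioc 0 ⌊x⌋₊, (∑ i ∈ s, if a i ∣ n then w i * a i else 0) ^ 2
      = ∑ i ∈ s, ∑ j ∈ s, ∑ n ∈ Finset.Ioc 0 ⌊x⌋₊,
        (if a i ∣ n then w i * a i else 0) * (if a j ∣ n then w j * a j else 0) := by
    simp_rw [pow_two, Finset.sum_mul_sum]
    rw [Finset.sum_comm]
    refine Finset.sum_congr rfl fun i _ => ?_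
    rw [Finset.sum_comm]
  rw [hexp]
  refine (Finset.sum_le_sum fun i hi => Finset.sum_le_sum fun j hj => hterm i hi j hj).trans ?_
  simp_rw [Finset.sum_add_distrib, ← Finset.mul_sum, Finset.sum_ite_eq]
  rw [Finset.sum_ite_mem, Finset.inter_self, ← Finset.mul_sum, pow_two, Finset.sum_mul]

theorem sum_weighted_divisors_ge (ha : ∀ i ∈ s, (a i).Prime)
    (hw0 : ∀ i ∈ s, 0 ≤ w i) (hw1 : ∀ i ∈ s, w i * a i ≤ 1) (x : ℝ) :
    x * ∑ i ∈ s, w i - s.card ≤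
      ∑ n ∈ Finset.Ioc 0 ⌊x⌋₊, ∑ i ∈ s, (if a i ∣ n then w i * a i else 0) := by
  rw [Finset.sum_comm, Finset.mul_sum]
  have h1 : (s.card : ℝ) = ∑ _i ∈ s, (1 : ℝ) := by simp
  rw [h1, ← Finset.sum_sub_distrib]
  refine Finset.sum_le_sum fun i hi => ?_
  have hai : (0 : ℝ) < a i := by exact_mod_cast (ha i hi).pos
  have hci : 0 ≤ w i * a i := mul_nonneg (hw0 i hi) hai.le
  rw [← Finset.sum_filter, Finset.sum_const, Nat.Ioc_filter_dvd_card_eq_div, nsmul_eq_mul,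
    ← Nat.floor_div_natCast]
  have h2 := mul_le_mul_of_nonneg_right (Nat.lt_floor_add_one (x / a i)).le hci
  have h3 : x / a i * (w i * a i) = x * w i := by field_simp
  have h4 := hw1 i hi
  nlinarith

/-- A weighted Turán–Kubilius inequality. -/
theorem sum_abs_weighted_divisors_sub_le (ha : ∀ i ∈ s, (a i).Prime)
    (hinj : Set.InjOn a s) (hw0 : ∀ i ∈ s, 0 ≤ w i) (hw1 : ∀ i ∈ s, w i * a i ≤ 1)
    (hL : 0 < ∑ i ∈ s, w i) {x : ℝ} (hx : 2 * (s.card : ℝ) ≤ x) :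
    ∑ n ∈ Finset.Ioc 0 ⌊x⌋₊, |(∑ i ∈ s, if a i ∣ n then w i * a i else 0) - ∑ i ∈ s, w i|
      ≤ 2 * x * √(∑ i ∈ s, w i) := by
  classical
  have hx0 : 0 ≤ x := le_trans (by positivity) hx
  have h2 := sum_sq_weighted_divisors_le ha hinj hw0 hw1 hx0
  have h1 := sum_weighted_divisors_ge ha hw0 hw1 x
  set L := ∑ i ∈ s, w i with hLdef
  set W : ℕ → ℝ := fun n => ∑ i ∈ s, if a i ∣ n then w i * a i else 0 with hW
  have hM : (⌊x⌋₊ : ℝ) ≤ x := Nat.floor_le hx0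
  -- The terms in `x * L ^ 2` cancel; the rounding loss `2 * L * s.card` is absorbed by `2 * s.card
  -- ≤ x`.
  have hvar : ∑ n ∈ Finset.Ioc 0 ⌊x⌋₊, (W n - L) ^ 2 ≤ 2 * x * L := by
    have : ∑ n ∈ Finset.Ioc 0 ⌊x⌋₊, (W n - L) ^ 2 = ∑ n ∈ Finset.Ioc 0 ⌊x⌋₊, W n ^ 2
        - 2 * L * ∑ n ∈ Finset.Ioc 0 ⌊x⌋₊, W n + ⌊x⌋₊ * L ^ 2 := by
      simp_rw [sub_sq, Finset.sum_add_distrib, Finset.sum_sub_distrib, Finset.mul_sum]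
      simp only [Finset.sum_const, Nat.card_Ioc, nsmul_eq_mul, Nat.sub_zero]
      congr 2
      refine Finset.sum_congr rfl fun n _ => by ring
    rw [this]
    have h3 := mul_le_mul_of_nonneg_left h1 (show 0 ≤ 2 * L by positivity)
    have h4 := mul_le_mul_of_nonneg_right hM (sq_nonneg L)
    have h5 := mul_le_mul_of_nonneg_right hx hL.le
    simp only [hW] at h3 ⊢
    nlinarith
  have hs : 0 < √L := Real.sqrt_pos.2 hL
  have hss : √L * √L = L := Real.mul_self_sqrt hL.le
  -- AM–GM with parameter `√L` replaces Cauchy–Schwarz.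
  have hpt : ∀ n ∈ Finset.Ioc 0 ⌊x⌋₊, |W n - L| ≤ √L / 2 + (W n - L) ^ 2 / (2 * √L) := by
    intro n _
    rw [← sq_abs]
    have h6 : √L / 2 + |W n - L| ^ 2 / (2 * √L) - |W n - L| = (√L - |W n - L|) ^ 2 / (2 * √L) := by
      field_simp
      ring
    have h7 : 0 ≤ (√L - |W n - L|) ^ 2 / (2 * √L) := by positivity
    linarith
  refine (Finset.sum_le_sum hpt).trans ?_
  have h8 : (∑ n ∈ Finset.Ioc 0 ⌊x⌋₊, (W n - L) ^ 2) / (2 * √L) ≤ x * √L := by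
    rw [div_le_iff₀ (by positivity)]
    nlinarith
  rw [Finset.sum_div] at h8
  rw [Finset.sum_add_distrib, Finset.sum_const, Nat.card_Ioc, nsmul_eq_mul, Nat.sub_zero]
  nlinarith [mul_le_mul_of_nonneg_right hM hs.le, mul_nonneg hx0 hs.le]

theorem sum_inv_sq_le_two (ha : ∀ i ∈ s, (a i).Prime) (hinj : Set.InjOn a s) :
    ∑ i ∈ s, ((a i : ℝ) ^ 2)⁻¹ ≤ 2 := by
  classical
  rw [← Finset.sum_image (f := fun k : ℕ => ((k : ℝ) ^ 2)⁻¹) hinj]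
  obtain ⟨n, hn⟩ := (s.image a).exists_nat_subset_range
  refine (Finset.sum_le_sum_of_subset_of_nonneg (t := Finset.Ioo 0 n) ?_ ?_).trans
    ((sum_Ioo_inv_sq_le 0 n).trans (by norm_num))
  · intro k hk
    obtain ⟨i, hi, rfl⟩ := Finset.mem_image.1 hk
    exact Finset.mem_Ioo.2 ⟨(ha i hi).pos, Finset.mem_range.1 (hn hk)⟩
  · intro k _ _
    positivity

/-- Insert the weighted divisor count into the sum of `f (ω n)` and exchange sums. The `2 * √L` is
the Turán–Kubilius error; the `4` comes from multiples of `p ^ 2`, through `∑ 1 / p ^ 2 ≤ 2`. -/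
theorem norm_mul_omegaAverage_sub_le (ha : ∀ i ∈ s, (a i).Prime)
    (hinj : Set.InjOn a s) (hw0 : ∀ i ∈ s, 0 ≤ w i) (hw1 : ∀ i ∈ s, w i * a i ≤ 1)
    (hL : 0 < ∑ i ∈ s, w i) {x : ℝ} (hx0 : 0 < x) (hx : 2 * (s.card : ℝ) ≤ x)
    {f : ℕ → ℂ} (hf : ∀ n, ‖f n‖ ≤ 1) :
    ‖((∑ i ∈ s, w i : ℝ) : ℂ) * omegaAverage f x
      - ∑ i ∈ s, (w i : ℂ) * omegaAverage (fun n => f (n + 1)) (x / a i)‖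
      ≤ 2 * √(∑ i ∈ s, w i) + 4 := by
  have hTK := sum_abs_weighted_divisors_sub_le ha hinj hw0 hw1 hL hx
  set L := ∑ i ∈ s, w i with hLdef
  set W : ℕ → ℝ := fun n => ∑ i ∈ s, if a i ∣ n then w i * a i else 0 with hW
  set M := ⌊x⌋₊ with hMdef
  have hM : (M : ℝ) ≤ x := Nat.floor_le hx0.le
  let F : ℕ → ℂ := fun n => f (ArithmeticFunction.cardDistinctFactors n)
  let G : ℕ → ℂ := fun n => f (ArithmeticFunction.cardDistinctFactors n + 1)
  have hxc : (x : ℂ) ≠ 0 := by exact_mod_cast hx0.ne'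
  have hsecond : ∀ i ∈ s, (w i : ℂ) * omegaAverage (fun n => f (n + 1)) (x / a i)
      = (x : ℂ)⁻¹ * ((w i * a i : ℝ) * ∑ m ∈ Finset.Ioc 0 (M / a i), G m) := by
    intro i hi
    have hai : (a i : ℂ) ≠ 0 := by exact_mod_cast (ha i hi).ne_zero
    rw [omegaAverage, Nat.floor_div_natCast]
    push_cast
    field_simp
    rfl
  have hWF : ∑ n ∈ Finset.Ioc 0 M, (W n : ℂ) * F n
      = ∑ i ∈ s, ((w i * a i : ℝ) : ℂ) * ∑ n ∈ Finset.Ioc 0 M, if a i ∣ n then F n else 0 := by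
    simp_rw [hW, Finset.mul_sum]
    rw [Finset.sum_comm]
    refine Finset.sum_congr rfl fun n _ => ?_
    push_cast
    rw [Finset.sum_mul]
    refine Finset.sum_congr rfl fun i _ => ?_
    split_ifs <;> simp
  have hsplit : (L : ℂ) * omegaAverage f x
      - ∑ i ∈ s, (w i : ℂ) * omegaAverage (fun n => f (n + 1)) (x / a i)
      = (x : ℂ)⁻¹ * (∑ n ∈ Finset.Ioc 0 M, ((L - W n : ℝ) : ℂ) * F n
        + ∑ i ∈ s, ((w i * a i : ℝ) : ℂ) * (∑ n ∈ Finset.Ioc 0 M, (if a i ∣ n then F n else 0)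
          - ∑ m ∈ Finset.Ioc 0 (M / a i), G m)) := by
    rw [Finset.sum_congr rfl hsecond, ← Finset.mul_sum]
    simp_rw [mul_sub, Finset.sum_sub_distrib]
    rw [← hWF]
    push_cast
    simp_rw [sub_mul, Finset.sum_sub_distrib, ← Finset.mul_sum]
    rw [omegaAverage]
    ring
  rw [hsplit, norm_mul, norm_inv, Complex.norm_real, Real.norm_of_nonneg hx0.le,
    inv_mul_le_iff₀ hx0]
  refine (norm_add_le _ _).trans ?_
  have hA : ‖∑ n ∈ Finset.Ioc 0 M, ((L - W n : ℝ) : ℂ) * F n‖ ≤ 2 * x * √L := by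
    refine (norm_sum_le _ _).trans (le_trans (Finset.sum_le_sum fun n _ => ?_) hTK)
    rw [norm_mul, Complex.norm_real, Real.norm_eq_abs, abs_sub_comm]
    exact mul_le_of_le_one_right (abs_nonneg _) (hf _)
  have hB : ‖∑ i ∈ s, ((w i * a i : ℝ) : ℂ) *
      (∑ n ∈ Finset.Ioc 0 M, (if a i ∣ n then F n else 0)
          - ∑ m ∈ Finset.Ioc 0 (M / a i), G m)‖ ≤ 4 * x := by
    refine (norm_sum_le _ _).trans ?_
    have h1 := mul_le_mul_of_nonneg_left (sum_inv_sq_le_two ha hinj)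
      (show 0 ≤ 2 * x by positivity)
    rw [Finset.mul_sum] at h1
    refine (Finset.sum_le_sum fun i hi => ?_).trans (h1.trans (by linarith))
    have hci : 0 ≤ w i * a i := mul_nonneg (hw0 i hi) (Nat.cast_nonneg _)
    rw [norm_mul, Complex.norm_real, Real.norm_of_nonneg hci]
    refine (mul_le_of_le_one_left (norm_nonneg _) (hw1 i hi)).trans ?_
    refine (norm_sum_multiples_sub_le hf (ha i hi) M).trans ?_
    rw [div_eq_mul_inv, ← mul_assoc]
    gcongr
  linarith

/-- After division by the total weight `L ≥ 1` the error is at most `6 / √L`, whence the threshold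
on `L`. -/
theorem norm_omegaAverage_sub_sum_le {δ : ℝ} (hδ : 0 < δ) (ha : ∀ i ∈ s, (a i).Prime)
    (hinj : Set.InjOn a s) (hw0 : ∀ i ∈ s, 0 ≤ w i) (hw1 : ∀ i ∈ s, w i * a i ≤ 1)
    (hL : 1 + (6 / δ) ^ 2 ≤ ∑ i ∈ s, w i) {x : ℝ} (hx0 : 0 < x) (hx : 2 * (s.card : ℝ) ≤ x)
    {f : ℕ → ℂ} (hf : ∀ n, ‖f n‖ ≤ 1) :
    ‖omegaAverage f x - ∑ i ∈ s, ((w i / ∑ j ∈ s, w j : ℝ) : ℂ) *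
        omegaAverage (fun n => f (n + 1)) (x / a i)‖ ≤ δ := by
  have hL0 : 0 < ∑ i ∈ s, w i := lt_of_lt_of_le (by positivity) hL
  have h := norm_mul_omegaAverage_sub_le ha hinj hw0 hw1 hL0 hx0 hx hf
  set L := ∑ i ∈ s, w i with hLdef
  have hLc : (L : ℂ) ≠ 0 := by exact_mod_cast hL0.ne'
  have heq : omegaAverage f x - ∑ i ∈ s, ((w i / L : ℝ) : ℂ) *
        omegaAverage (fun n => f (n + 1)) (x / a i)
      = (L : ℂ)⁻¹ * ((L : ℂ) * omegaAverage f x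
        - ∑ i ∈ s, (w i : ℂ) * omegaAverage (fun n => f (n + 1)) (x / a i)) := by
    rw [mul_sub, inv_mul_cancel_left₀ hLc, Finset.mul_sum]
    congr 1
    refine Finset.sum_congr rfl fun i _ => ?_
    push_cast
    ring
  rw [heq, norm_mul, norm_inv, Complex.norm_real, Real.norm_of_nonneg hL0.le,
    inv_mul_le_iff₀ hL0]
  refine h.trans ?_
  have h1 : 1 ≤ √L := Real.one_le_sqrt.2 (by nlinarith [sq_nonneg (6 / δ)])
  have h2 : 6 / δ ≤ √L := Real.le_sqrt_of_sq_le (by linarith)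
  rw [div_le_iff₀ hδ] at h2
  have h3 : √L * √L = L := Real.mul_self_sqrt hL0.le
  nlinarith

end TuranKubilius

/-! ### Slow variation and shift invariance -/

theorem norm_omegaAverage_div_sub_le {f : ℕ → ℂ} (hf : ∀ n, ‖f n‖ ≤ 1) {r x : ℝ} (hr : 1 ≤ r)
    (hx : 0 < x) : ‖omegaAverage f (x / r) - omegaAverage f x‖ ≤ 2 * (r - 1) + 1 / x := by
  have hr0 : 0 < r := by linarith
  set y := x / r with hy
  have hy0 : 0 < y := by positivity
  have hyx : y ≤ x := div_le_self hx.le hr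
  have hfl : ⌊y⌋₊ ≤ ⌊x⌋₊ := Nat.floor_mono hyx
  let F : ℕ → ℂ := fun n => f (ArithmeticFunction.cardDistinctFactors n)
  have hsum : ∑ n ∈ Finset.Ioc 0 ⌊x⌋₊, F n
      = ∑ n ∈ Finset.Ioc 0 ⌊y⌋₊, F n + ∑ n ∈ Finset.Ioc ⌊y⌋₊ ⌊x⌋₊, F n :=
    (Finset.sum_Ioc_consecutive F (Nat.zero_le _) hfl).symm
  have hbound : ∀ m n : ℕ, m ≤ n → ‖∑ n ∈ Finset.Ioc m n, F n‖ ≤ (n : ℝ) - m := by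
    intro m n hmn
    refine (norm_sum_le_of_le (n := fun _ => (1 : ℝ)) _ fun k _ => hf _).trans ?_
    simp [Nat.cast_sub hmn]
  have h1 := hbound 0 ⌊y⌋₊ (Nat.zero_le _)
  have h2 := hbound _ _ hfl
  have h3 : (⌊y⌋₊ : ℝ) ≤ y := Nat.floor_le hy0.le
  have h4 : (⌊x⌋₊ : ℝ) ≤ x := Nat.floor_le hx.le
  have h5 : y < ⌊y⌋₊ + 1 := Nat.lt_floor_add_one y
  have heq : omegaAverage f y - omegaAverage f x
      = ((y⁻¹ - x⁻¹ : ℝ) : ℂ) * ∑ n ∈ Finset.Ioc 0 ⌊y⌋₊, F n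
        - ((x⁻¹ : ℝ) : ℂ) * ∑ n ∈ Finset.Ioc ⌊y⌋₊ ⌊x⌋₊, F n := by
    change (y : ℂ)⁻¹ * ∑ n ∈ Finset.Ioc 0 ⌊y⌋₊, F n - (x : ℂ)⁻¹ * ∑ n ∈ Finset.Ioc 0 ⌊x⌋₊, F n = _
    rw [hsum]
    push_cast
    ring
  rw [heq]
  refine (norm_sub_le _ _).trans ?_
  have h6 : 0 ≤ y⁻¹ - x⁻¹ := sub_nonneg.2 (inv_anti₀ hy0 hyx)
  rw [norm_mul, norm_mul, Complex.norm_real, Complex.norm_real, Real.norm_of_nonneg h6,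
    Real.norm_of_nonneg (by positivity)]
  have h7 : (y⁻¹ - x⁻¹) * ‖∑ n ∈ Finset.Ioc 0 ⌊y⌋₊, F n‖ ≤ (y⁻¹ - x⁻¹) * y := by
    gcongr
    simp only [Nat.cast_zero, sub_zero] at h1
    linarith
  have h8 : x⁻¹ * ‖∑ n ∈ Finset.Ioc ⌊y⌋₊ ⌊x⌋₊, F n‖ ≤ x⁻¹ * (x - y + 1) := by
    gcongr
    linarith
  have h9 : (y⁻¹ - x⁻¹) * y + x⁻¹ * (x - y + 1) = 2 * (1 - r⁻¹) + 1 / x := by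
    rw [hy]
    field_simp
    ring
  have h10 : 1 - r⁻¹ ≤ r - 1 := by
    have : r * r⁻¹ = 1 := mul_inv_cancel₀ hr0.ne'
    nlinarith [inv_pos.2 hr0, sq_nonneg (r - 1)]
  linarith

theorem norm_sum_weights_mul_le {ι : Type*} {s : Finset ι} {w : ι → ℝ} {z : ι → ℂ} {e : ℝ}
    (hw0 : ∀ i ∈ s, 0 ≤ w i) (hL : 0 < ∑ i ∈ s, w i) (hz : ∀ i ∈ s, ‖z i‖ ≤ e) :
    ‖∑ i ∈ s, ((w i / ∑ j ∈ s, w j : ℝ) : ℂ) * z i‖ ≤ e := by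
  refine (norm_sum_le_of_le (n := fun i => (w i / ∑ j ∈ s, w j) * e) _ fun i hi => ?_).trans ?_
  · have := div_nonneg (hw0 i hi) hL.le
    rw [norm_mul, Complex.norm_real, Real.norm_of_nonneg this]
    exact mul_le_mul_of_nonneg_left (hz i hi) this
  · rw [← Finset.sum_mul, ← Finset.sum_div, div_self hL.ne', one_mul]

/-- Averages of bounded functions of `ω` vary slowly. -/
theorem eventually_norm_omegaAverage_div_sub_le {r e : ℝ} (hr : 1 ≤ r) (he : 0 < e) :
    ∀ᶠ x : ℝ in Filter.atTop, ∀ f : ℕ → ℂ, (∀ n, ‖f n‖ ≤ 1) →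
      ‖omegaAverage f (x / r) - omegaAverage f x‖ ≤ e := by
  set β : ℝ := 1 + e / 4 with hβ
  have hβ1 : 1 < β := by rw [hβ]; linarith
  have hβ0 : 0 < β := by linarith
  obtain ⟨ρ, hρ, hpairs⟩ := exists_prime_pairs hβ1
  have hρ0 : 0 < ρ := by linarith
  -- The trivial loss `e / 2` is paid only in the base case, so the bound does not grow with `k`.
  -- Uniformity in `f` is essential, as each step replaces `f` by its shift.
  have key : ∀ k : ℕ, ∀ r δ : ℝ, 1 ≤ r → r ≤ β * ρ ^ k → 0 < δ →
      ∀ᶠ x : ℝ in Filter.atTop, ∀ f : ℕ → ℂ, (∀ n, ‖f n‖ ≤ 1) →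
        ‖omegaAverage f (x / r) - omegaAverage f x‖ ≤ e / 2 + δ := by
    have base : ∀ r δ : ℝ, 1 ≤ r → r ≤ β → 0 < δ →
        ∀ᶠ x : ℝ in Filter.atTop, ∀ f : ℕ → ℂ, (∀ n, ‖f n‖ ≤ 1) →
          ‖omegaAverage f (x / r) - omegaAverage f x‖ ≤ e / 2 + δ := by
      intro r δ hr hrβ hδ
      filter_upwards [Filter.eventually_ge_atTop (1 / δ), Filter.eventually_gt_atTop 0]
        with x hx hx0 f hf
      refine (norm_omegaAverage_div_sub_le hf hr hx0).trans ?_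
      have : 1 / x ≤ δ := by
        rw [div_le_iff₀ hδ] at hx
        rw [div_le_iff₀ hx0]
        linarith
      linarith
    intro k
    induction k with
    | zero =>
      intro r δ hr hrk hδ
      exact base r δ hr (by simpa using hrk) hδ
    | succ k ih =>
      intro r δ hr hrk hδ
      rcases le_or_gt r β with hrβ | hrβ
      · exact base r δ hr hrβ hδ
      -- Two expansion errors `δ / 4` plus the inductive `e / 2 + δ / 2` add up to `e / 2 + δ`.
      obtain ⟨R, hR, hinj1, hinj2, hL⟩ := hpairs (1 + (6 / (δ / 4)) ^ 2)
      have hr0 : 0 < r := by linarith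
      have hstep : ∀ᶠ x : ℝ in Filter.atTop, ∀ q ∈ R, ∀ f : ℕ → ℂ, (∀ n, ‖f n‖ ≤ 1) →
          ‖omegaAverage f (x / r / q.1) - omegaAverage f (x / q.2)‖ ≤ e / 2 + δ / 2 := by
        rw [Filter.eventually_all_finset]
        intro q hq
        obtain ⟨hp1, hp2, h1, h2⟩ := hR q hq
        have hq1 : (0 : ℝ) < q.1 := by exact_mod_cast hp1.pos
        have hq2 : (0 : ℝ) < q.2 := by exact_mod_cast hp2.pos
        -- Here `r > β` and `q.2 ≤ β * q.1` are used; the bound `ρ * q.1 ≤ q.2` then removes one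
        -- factor `ρ` from above.
        have h3 : 1 ≤ r * q.1 / q.2 := by
          rw [le_div_iff₀ hq2]
          nlinarith
        have h4 : r * q.1 / q.2 ≤ β * ρ ^ k := by
          rw [div_le_iff₀ hq2]
          calc r * q.1 ≤ β * ρ ^ (k + 1) * q.1 := by gcongr
            _ = β * ρ ^ k * (ρ * q.1) := by ring
            _ ≤ β * ρ ^ k * q.2 := by gcongr
        have h5 := (Filter.tendsto_id.atTop_div_const hq2).eventually
          (ih _ (δ / 2) h3 h4 (half_pos hδ))
        filter_upwards [h5] with x hx f hf
        have h6 : x / r / q.1 = x / q.2 / (r * q.1 / q.2) := by field_simp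
        rw [h6]
        exact hx f hf
      filter_upwards [hstep, Filter.eventually_gt_atTop 0,
        Filter.eventually_ge_atTop (2 * (R.card : ℝ) * r)] with x hx hx0 hxR f hf
      have hw0 : ∀ q ∈ R, 0 ≤ 1 / (q.2 : ℝ) := fun q _ => by positivity
      have hLpos : 0 < ∑ q ∈ R, 1 / (q.2 : ℝ) := lt_of_lt_of_le (by positivity) hL
      have hxr : 2 * (R.card : ℝ) ≤ x / r := (le_div_iff₀ hr0).2 hxR
      -- The weights `1 / q.2` are admissible for `q.1` too, since `q.1 ≤ q.2`; sharing them lets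
      -- the expansions be compared term by term.
      have t1 := norm_omegaAverage_sub_sum_le (a := Prod.fst) (w := fun q : ℕ × ℕ => 1 / (q.2 : ℝ))
        (show 0 < δ / 4 by positivity) (fun q hq => (hR q hq).1) hinj1 hw0
        (fun q hq => by
          obtain ⟨hp1, hp2, h1, h2⟩ := hR q hq
          have hq2 : (0 : ℝ) < q.2 := by exact_mod_cast hp2.pos
          have hq1 : (0 : ℝ) ≤ q.1 := Nat.cast_nonneg _
          rw [one_div_mul_eq_div, div_le_one hq2]
          nlinarith) hL (div_pos hx0 hr0) hxr hf
      have t2 := norm_omegaAverage_sub_sum_le (a := Prod.snd) (w := fun q : ℕ × ℕ => 1 / (q.2 : ℝ))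
        (show 0 < δ / 4 by positivity) (fun q hq => (hR q hq).2.1) hinj2 hw0
        (fun q hq => by
          have hq2 : (q.2 : ℝ) ≠ 0 := by exact_mod_cast (hR q hq).2.1.ne_zero
          rw [one_div_mul_cancel hq2]) hL hx0 (hxr.trans (div_le_self hx0.le hr)) hf
      have t3 := norm_sum_weights_mul_le hw0 hLpos
        (fun q hq => hx q hq (fun n => f (n + 1)) fun n => hf _)
      simp_rw [mul_sub, Finset.sum_sub_distrib] at t3
      rw [norm_sub_rev] at t2
      refine (norm_sub_le_norm_sub_add_norm_sub _ _ _).trans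
        ((add_le_add t1 ((norm_sub_le_norm_sub_add_norm_sub _ _ _).trans
          (add_le_add t3 t2))).trans ?_)
      linarith
  obtain ⟨k, hk⟩ := pow_unbounded_of_one_lt r hρ
  have := key k r (e / 2) hr (hk.le.trans (le_mul_of_one_le_left (by positivity) hβ1.le))
    (half_pos he)
  simpa only [add_halves] using this

/-- Averages of bounded functions of `ω` are asymptotically invariant under `ω ↦ ω + 1`. -/
theorem eventually_norm_omegaAverage_sub_shift_le {e : ℝ} (he : 0 < e) :
    ∀ᶠ x : ℝ in Filter.atTop, ∀ f : ℕ → ℂ, (∀ n, ‖f n‖ ≤ 1) →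
      ‖omegaAverage f x - omegaAverage (fun n => f (n + 1)) x‖ ≤ e := by
  -- Only a heavy set of primes is wanted here, namely the second coordinates; the ratio bound `2`
  -- plays no role.
  obtain ⟨ρ, _, hpairs⟩ := exists_prime_pairs (show (1 : ℝ) < 2 by norm_num)
  obtain ⟨R, hR, _, hinj, hL⟩ := hpairs (1 + (6 / (e / 2)) ^ 2)
  have hslow : ∀ᶠ x : ℝ in Filter.atTop, ∀ q ∈ R, ∀ f : ℕ → ℂ, (∀ n, ‖f n‖ ≤ 1) →
      ‖omegaAverage f (x / q.2) - omegaAverage f x‖ ≤ e / 2 := by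
    rw [Filter.eventually_all_finset]
    intro q hq
    exact eventually_norm_omegaAverage_div_sub_le
      (by exact_mod_cast (hR q hq).2.1.one_le) (half_pos he)
  filter_upwards [hslow, Filter.eventually_gt_atTop 0,
    Filter.eventually_ge_atTop (2 * (R.card : ℝ))] with x hx hx0 hxR f hf
  have hw0 : ∀ q ∈ R, 0 ≤ 1 / (q.2 : ℝ) := fun q _ => by positivity
  have hLpos : 0 < ∑ q ∈ R, 1 / (q.2 : ℝ) := lt_of_lt_of_le (by positivity) hL
  have t1 := norm_omegaAverage_sub_sum_le (a := Prod.snd) (w := fun q : ℕ × ℕ => 1 / (q.2 : ℝ))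
    (half_pos he) (fun q hq => (hR q hq).2.1) hinj hw0
    (fun q hq => by
      have hq2 : (q.2 : ℝ) ≠ 0 := by exact_mod_cast (hR q hq).2.1.ne_zero
      rw [one_div_mul_cancel hq2]) hL hx0 hxR hf
  have t2 := norm_sum_weights_mul_le hw0 hLpos
    (fun q hq => hx q hq (fun n => f (n + 1)) fun n => hf _)
  simp_rw [mul_sub, Finset.sum_sub_distrib] at t2
  rw [← Finset.sum_mul, ← Complex.ofReal_sum, ← Finset.sum_div, div_self hLpos.ne',
    Complex.ofReal_one, one_mul] at t2
  refine (norm_sub_le_norm_sub_add_norm_sub _ _ _).trans ((add_le_add t1 t2).trans ?_)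
  linarith
theorem tendsto_omegaAverage_sub_shift {f : ℕ → ℂ} {C : ℝ} (hf : ∀ n, ‖f n‖ ≤ C) :
    Filter.Tendsto
      (fun x : ℝ => omegaAverage (fun n => f (n + 1)) x - omegaAverage f x)
      Filter.atTop (nhds 0) := by
  have hC : 0 ≤ C := (norm_nonneg _).trans (hf 0)
  -- Normalizing by `C + 1` avoids dividing by zero when `C = 0`.
  have hC1 : 0 < C + 1 := by linarith
  have hC1c : ((C + 1 : ℝ) : ℂ) ≠ 0 := by exact_mod_cast hC1.ne'
  have hscale : ∀ (g : ℕ → ℂ) (x : ℝ), omegaAverage g x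
      = ((C + 1 : ℝ) : ℂ) * omegaAverage (fun n => ((C + 1 : ℝ) : ℂ)⁻¹ * g n) x := by
    intro g x
    rw [omegaAverage, omegaAverage, ← Finset.mul_sum, mul_left_comm, mul_inv_cancel_left₀ hC1c]
  rw [Metric.tendsto_nhds]
  intro ε hε
  filter_upwards [eventually_norm_omegaAverage_sub_shift_le
    (show 0 < ε / (2 * (C + 1)) by positivity)] with x hx
  have h := hx (fun n => ((C + 1 : ℝ) : ℂ)⁻¹ * f n) fun n => by
    rw [norm_mul, norm_inv, Complex.norm_real, Real.norm_of_nonneg hC1.le, inv_mul_le_iff₀ hC1]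
    linarith [hf n]
  rw [dist_zero_right, hscale f, hscale (fun n => f (n + 1)), ← mul_sub, norm_mul,
    Complex.norm_real, Real.norm_of_nonneg hC1.le, norm_sub_rev]
  calc (C + 1) * _ ≤ (C + 1) * (ε / (2 * (C + 1))) := mul_le_mul_of_nonneg_left h hC1.le
    _ = ε / 2 := by field_simp
    _ < ε := half_lt_self hε

/-! ### Empirical measures along `ω` -/

section EmpiricalMeasure

variable {X : Type*} [MeasurableSpace X]

/-- The uniform probability measure on the points `T^[ω n] x` for `1 ≤ n ≤ N + 1`. -/
noncomputable def omegaOrbitMeasure (T : X → X) (x : X) (N : ℕ) : MeasureTheory.Measure X :=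
  ((N + 1 : ℕ) : ENNReal)⁻¹ • ∑ n ∈ Finset.Ioc 0 (N + 1),
    MeasureTheory.Measure.dirac (T^[ArithmeticFunction.cardDistinctFactors n] x)

instance isProbabilityMeasure_omegaOrbitMeasure (T : X → X) (x : X) (N : ℕ) :
    MeasureTheory.IsProbabilityMeasure (omegaOrbitMeasure T x N) := by
  refine ⟨?_⟩
  simp only [omegaOrbitMeasure, MeasureTheory.Measure.smul_apply,
    MeasureTheory.Measure.finsetSum_apply, MeasureTheory.measure_univ, Finset.sum_const,
    Nat.card_Ioc, Nat.sub_zero, nsmul_eq_mul, mul_one, smul_eq_mul]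
  exact ENNReal.inv_mul_cancel (by simp) (ENNReal.natCast_ne_top _)

/-- `omegaOrbitMeasure` as a bundled probability measure. -/
noncomputable def omegaOrbitProbabilityMeasure (T : X → X) (x : X) (N : ℕ) :
    MeasureTheory.ProbabilityMeasure X :=
  ⟨omegaOrbitMeasure T x N, isProbabilityMeasure_omegaOrbitMeasure T x N⟩

variable [TopologicalSpace X] [BorelSpace X] [CompactSpace X]

theorem integral_omegaOrbitMeasure [T2Space X] (T : X → X) (x : X) (N : ℕ) (g : C(X, ℂ)) :
    ∫ y, g y ∂(omegaOrbitMeasure T x N)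
      = omegaAverage (fun k => g (T^[k] x)) ((N + 1 : ℕ) : ℝ) := by
  have hg := g.continuous.stronglyMeasurable_of_hasCompactSupport
    (HasCompactSupport.of_compactSpace g)
  rw [omegaOrbitMeasure, MeasureTheory.integral_smul_measure,
    MeasureTheory.integral_finsetSum_measure, omegaAverage, Nat.floor_natCast]
  · simp_rw [MeasureTheory.integral_dirac' _ _ hg]
    rw [ENNReal.toReal_inv, ENNReal.toReal_natCast, Complex.real_smul]
    push_cast
    rfl
  · intro n _
    exact MeasureTheory.integrable_dirac' hg (by simp)

theorem tendsto_integral_omegaOrbitMeasure_comp_sub [T2Space X] {T : X → X} (hT : Continuous T)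
    (x : X) (g : C(X, ℂ)) :
    Filter.Tendsto (fun N : ℕ => ∫ y, g (T y) ∂(omegaOrbitMeasure T x N)
      - ∫ y, g y ∂(omegaOrbitMeasure T x N)) Filter.atTop (nhds 0) := by
  have h := (tendsto_omegaAverage_sub_shift (f := fun k => g (T^[k] x))
    (fun n => g.norm_coe_le_norm _)).comp
    (tendsto_natCast_atTop_atTop.comp (Filter.tendsto_add_atTop_nat 1))
  refine h.congr fun N => ?_
  have h2 := integral_omegaOrbitMeasure T x N (g.comp ⟨T, hT⟩)
  simp only [ContinuousMap.comp_apply, ContinuousMap.coe_mk, ← Function.iterate_succ_apply'] at h2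
  rw [integral_omegaOrbitMeasure, h2]
  rfl

end EmpiricalMeasure

/-! ### Weak limits and unique ergodicity -/

section UniqueErgodicity

open MeasureTheory

variable {X : Type*} [MetricSpace X] [CompactSpace X] [MeasurableSpace X] [BorelSpace X]

/-- Every weak limit of the orbit measures is `T`-invariant. -/
theorem measurePreserving_of_tendsto_omegaOrbitMeasure {T : X → X} (hT : Continuous T) (x : X)
    {F : Filter ℕ} [F.NeBot] (hF : F ≤ Filter.atTop) {ν : ProbabilityMeasure X}
    (hν : Filter.Tendsto (omegaOrbitProbabilityMeasure T x) F (nhds ν)) :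
    MeasurePreserving T (ν : Measure X) (ν : Measure X) := by
  have hlim := (ProbabilityMeasure.tendsto_iff_forall_integral_rclike_tendsto ℂ).1 hν
  have hmeas := hT.measurable
  have : IsProbabilityMeasure ((ν : Measure X).map T) :=
    Measure.isProbabilityMeasure_map hmeas.aemeasurable
  refine ⟨hmeas, ?_⟩
  refine ext_of_forall_integral_eq_of_IsFiniteMeasure fun g => ?_
  rw [integral_map hmeas.aemeasurable g.continuous.aestronglyMeasurable]
  let G : C(X, ℂ) := ⟨fun y => (g y : ℂ), by fun_prop⟩
  have h1 := hlim (BoundedContinuousFunction.mkOfCompact G)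
  have h2 := hlim (BoundedContinuousFunction.mkOfCompact (G.comp ⟨T, hT⟩))
  have h3 := (tendsto_integral_omegaOrbitMeasure_comp_sub hT x G).mono_left hF
  have h4 := tendsto_nhds_unique (h2.sub h1) h3
  have h5 : ∫ y, (g (T y) : ℂ) ∂(ν : Measure X) = ∫ y, (g y : ℂ) ∂(ν : Measure X) :=
    sub_eq_zero.1 h4
  rw [integral_complex_ofReal, integral_complex_ofReal] at h5
  exact_mod_cast h5

/-- By weak compactness every ultrafilter finer than `atTop` has a limit measure; invariance and
uniqueness identify it with `μ`. -/
theorem tendsto_omegaOrbitMeasure {T : X → X} (hT : Continuous T) {μ : Measure X}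
    (hμ : IsUniquelyErgodic T μ) (x : X) :
    Filter.Tendsto (omegaOrbitProbabilityMeasure T x) Filter.atTop
      (nhds (⟨μ, hμ.isProbabilityMeasure⟩ : ProbabilityMeasure X)) := by
  rw [Filter.tendsto_iff_ultrafilter]
  intro U hU
  obtain ⟨ν, -, hν⟩ := isCompact_univ.ultrafilter_le_nhds
    (U.map (omegaOrbitProbabilityMeasure T x)) (by simp)
  have heq : (ν : Measure X) = μ := hμ.unique ν inferInstance
    (measurePreserving_of_tendsto_omegaOrbitMeasure hT x hU hν)
  have : ν = (⟨μ, hμ.isProbabilityMeasure⟩ : ProbabilityMeasure X) := Subtype.ext heq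
  rwa [← this]

end UniqueErgodicity

theorem mainTheorem10 {X : Type*} [MetricSpace X] [CompactSpace X]
    [MeasurableSpace X] [BorelSpace X]
    (T : X → X) (hT : Continuous T)
    (μ : MeasureTheory.Measure X) (hμ : IsUniquelyErgodic T μ)
    (f : C(X, ℂ)) (x : X) :
    Filter.Tendsto
      (fun N : ℕ => (1 / (N : ℂ)) *
        ∑ n ∈ Finset.Icc 1 N, f (T^[ArithmeticFunction.cardDistinctFactors n] x))
      Filter.atTop (nhds (∫ y, f y ∂μ)) := by
  -- The orbit measure of index `N` has `N + 1` points, so the empty average `N = 0` is dropped.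
  rw [← Filter.tendsto_add_atTop_iff_nat 1]
  have h := (MeasureTheory.ProbabilityMeasure.tendsto_iff_forall_integral_rclike_tendsto ℂ).1
    (tendsto_omegaOrbitMeasure hT hμ x) (BoundedContinuousFunction.mkOfCompact f)
  refine h.congr fun N => ?_
  refine (integral_omegaOrbitMeasure T x N f).trans ?_
  rw [omegaAverage, Nat.floor_natCast, one_div]
  push_cast
  rfl
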